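/- For $m\ge 1$, $\boldsymbol d=(d_1,\dots,d_m)$, $\boldsymbol s=(s_1,\dots,s_m)$ with all $d_k,s_k\ge 1$, and $M>0$, let $\mathcal P(\boldsymbol d,\boldsymbol s,M)$ be the set of all tensors $\Theta\in\mathbb R^{d_1\times\cdots\times d_m}$ of the form $$\Theta(i_1,\dots,i_m)=f(\boldsymbol a^{(1)}_{i_1},\dots,\boldsymbol a^{(m)}_{i_m}),\qquad (i_1,\dots,i_m)\in[d_1]\times\cdots\times[d_m],$$ where the latent vectors $\boldsymbol a^{(k)}_{i}\in\mathbb R^{s_k}$ satisfy $\|\boldsymbol a^{(k)}_{i}\|_\infty\le 1$ and $f:\mathbb R^{s_1}\times\cdots\times\mathbb R^{s_m}\to\mathbb R$ is $M$-analytic, i.e. $f$ is real analytic at every point of the product $B$ of the closed $\|\cdot\|_\infty$-unit balls and $\sup_{\boldsymbol x\in B}|\partial^{\boldsymbol\alpha}f(\boldsymbol x)|\le M^{|\boldsymbol\alpha|}\boldsymbol\alpha!$ for all multi-indices $\boldsymbol\alpha\in\mathbb N^{s_1+\cdots+s_m}$ (including $\boldsymbol\alpha=0$). One observes $\mathcal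 Y=\Theta+\mathcal E$, where the entries of $\mathcal E$ are i.i.d. standard Gaussian; write $\mathbb P_\Theta$ for the law of $\mathcal Y$, $\|\cdot\|_F$ for the Frobenius norm and $\bar d=\max_k d_k$. Then there is an absolute constant $p_0\in(0,1)$ such that for all $m\ge1$, all $\boldsymbol s$ with $s_k\ge 1$ and all $M>0$ there is a constant $C=C(m,\boldsymbol s,M)>0$, not depending on $\boldsymbol d$, such that for every $\boldsymbol d$ with all $d_k\ge 1$ $$\inf_{\hat\Theta}\ \sup_{\Theta\in\mathcal P(\boldsymbol d,\boldsymbol s,M)}\mathbb P_\Theta\left(\|\hat\Theta-\Theta\|_F^2\ge C\,\bar d\right)\ge p_0,$$ where the infimum is over all estimators, i.e. all measurable functions $\hat\Theta=\hat\Theta(\mathcal Y)$ with values in $\mathbb R^{d_1\times\cdots\times d_m}$. -/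

import Mathlib

open MeasureTheory ProbabilityTheory
open scoped Nat

noncomputable section

/-- Order-`m` real tensors of dimension `(d 0, …, d (m-1))`, with their entries indexed by
`(i_1, …, i_m)`. -/
abbrev Tensor {m : ℕ} (d : Fin m → ℕ) : Type :=
  ((k : Fin m) → Fin (d k)) → ℝ

/-- The Frobenius norm of a tensor. -/
def frobeniusNorm {m : ℕ} {d : Fin m → ℕ} (T : Tensor d) : ℝ :=
  Real.sqrt (∑ i, T i ^ 2)

/-- The largest dimension `max_k d_k`. -/
def maxDim {m : ℕ} (d : Fin m → ℕ) : ℕ :=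
  Finset.univ.sup d

/-- The product `ℝ^{s_1} × ⋯ × ℝ^{s_m}`. Its norm (an iterated `Pi` norm) is the infinity norm, so
that its closed unit ball is the product of the closed infinity-norm unit balls of the factors. -/
abbrev LatentSpace {m : ℕ} (s : Fin m → ℕ) : Type :=
  (k : Fin m) → (Fin (s k) → ℝ)

/-- The scalar coordinates `(k, j)`, `j ∈ [s_k]`, of `ℝ^{s_1} × ⋯ × ℝ^{s_m}`. -/
abbrev Coord {m : ℕ} (s : Fin m → ℕ) : Type :=
  (k : Fin m) × Fin (s k)

/-- The standard basis vector of `ℝ^{s_1} × ⋯ × ℝ^{s_m}` for the coordinate `c`. -/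
def coordVec {m : ℕ} {s : Fin m → ℕ} (c : Coord s) : LatentSpace s :=
  Pi.single c.1 (Pi.single c.2 1)

/-- `f` is `M`-analytic: it is real analytic at each point of the closed unit ball, and
`|∂^α f (x)| ≤ M^{|α|} α!` for every multi-index `α` (one exponent for each scalar coordinate) and
every `x` in that ball.
The mixed partial derivative `∂^α f (x)` is the `|α|`-th derivative of `f` at `x` evaluated at basis
vectors listed by `j`, in which each coordinate `c` occurs exactly `α c` times; as `f` is analytic
at `x`, the order of the list is immaterial. -/
def IsMAnalytic {m : ℕ} (s : Fin m → ℕ) (M : ℝ) (f : LatentSpace s → ℝ) : Prop :=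
  AnalyticOnNhd ℝ f (Metric.closedBall 0 1) ∧
  ∀ x ∈ Metric.closedBall (0 : LatentSpace s) 1,
    ∀ (α : Coord s → ℕ) (j : Fin (∑ c, α c) → Coord s),
      (∀ c, (Finset.univ.filter (fun i => j i = c)).card = α c) →
      |iteratedFDeriv ℝ (∑ c, α c) f x (fun i => coordVec (j i))|
        ≤ M ^ (∑ c, α c) * ((∏ c, (α c)! : ℕ) : ℝ)

/-- The latent variable tensor model `P(d, s, M)`: the tensors with entries
`Θ(i_1, …, i_m) = f(a^{(1)}_{i_1}, …, a^{(m)}_{i_m})`, where `f` is `M`-analytic and the latent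
vectors `a^{(k)}_i` lie in the closed infinity-norm unit ball of `ℝ^{s_k}`. -/
def latentTensorModel {m : ℕ} (d s : Fin m → ℕ) (M : ℝ) : Set (Tensor d) :=
  {Θ | ∃ f : LatentSpace s → ℝ, IsMAnalytic s M f ∧
    ∃ a : (k : Fin m) → Fin (d k) → (Fin (s k) → ℝ),
      (∀ k i, a k i ∈ Metric.closedBall (0 : Fin (s k) → ℝ) 1) ∧
      ∀ i : (k : Fin m) → Fin (d k), Θ i = f (fun k => a k (i k))}

/-- The law of a noise tensor with i.i.d. standard Gaussian entries. -/
def noiseLaw {m : ℕ} (d : Fin m → ℕ) : Measure (Tensor d) :=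
  Measure.pi (fun _ => gaussianReal 0 1)

/-- The law of the data tensor `Y = Θ + E`, where `E` has i.i.d. standard Gaussian entries. -/
def dataLaw {m : ℕ} {d : Fin m → ℕ} (Θ : Tensor d) : Measure (Tensor d) :=
  (noiseLaw d).map (fun E => Θ + E)

end

/-! A linear `f` already gives the bound. Let `k` be a mode with `d k = maxDim d` and `c = min 1 M`;
reading off one coordinate of the `k`-th latent vector and scaling it by `c` puts every tensor `c *
t (i k)` with `|t| ≤ 1` into the model (`mem_latentTensorModel_of_apply_eq`). This leaves `d k` free
parameters, one per slice. Letting each take two values whose tensors differ by `c ≤ 1` in Frobenius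
norm makes neighbours on the cube hard to tell apart (`one_quarter_le_gaussianLaw_add`). An Assouad
argument in probability (`exists_le_measureReal_card_of_hypercube`) then forces an error of order `c
^ 2` on a fixed fraction of the slices. -/

/-! ### Change of measure between Gaussian shifts -/

theorem pi_withDensity_eq_withDensity_prod {ι : Type*} [Fintype ι] {X : ι → Type*}
    [∀ i, MeasurableSpace (X i)] (μ : ∀ i, Measure (X i)) [∀ i, IsProbabilityMeasure (μ i)]
    {g : ∀ i, X i → ENNReal} (hg : ∀ i, Measurable (g i))
    [∀ i, SigmaFinite ((μ i).withDensity (g i))] :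
    Measure.pi (fun i => (μ i).withDensity (g i)) =
      (Measure.pi μ).withDensity (fun x => ∏ i, g i (x i)) := by
  refine Measure.pi_eq fun s hs => ?_
  rw [withDensity_apply _ (MeasurableSet.univ_pi hs),
    ← lintegral_indicator (MeasurableSet.univ_pi hs)]
  have hind : (Set.univ.pi s).indicator (fun x : ∀ i, X i => ∏ i, g i (x i)) =
      fun x => ∏ i, (s i).indicator (g i) (x i) := by
    funext x
    by_cases hx : x ∈ Set.univ.pi s
    · rw [Set.indicator_of_mem hx]
      exact Finset.prod_congr rfl fun i _ => (Set.indicator_of_mem (hx i trivial) _).symm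
    · rw [Set.indicator_of_notMem hx]
      obtain ⟨i, hi⟩ : ∃ i, x i ∉ s i := by simpa [Set.mem_pi] using hx
      exact (Finset.prod_eq_zero (Finset.mem_univ i) (Set.indicator_of_notMem hi _)).symm
  have hmeas (i : ι) : Measurable ((s i).indicator (g i)) := (hg i).indicator (hs i)
  have hindep : iIndepFun (fun i (x : ∀ i, X i) => (s i).indicator (g i) (x i)) (Measure.pi μ) :=
    iIndepFun_pi fun i => (hmeas i).aemeasurable
  rw [hind, lintegral_prod_eq_prod_lintegral_of_indepFun _ _ hindep
    fun i => (hmeas i).comp (measurable_pi_apply i)]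
  refine Finset.prod_congr rfl fun i _ => ?_
  rw [withDensity_apply _ (hs i), ← lintegral_indicator (hs i)]
  exact (measurePreserving_eval μ i).lintegral_comp (hmeas i)

theorem gaussianReal_eq_withDensity_gaussianReal (a b : ℝ) :
    gaussianReal b 1 = (gaussianReal a 1).withDensity
      (fun x => ENNReal.ofReal (Real.exp ((b - a) * (x - a) - (b - a) ^ 2 / 2))) := by
  rw [gaussianReal_of_var_ne_zero _ one_ne_zero, gaussianReal_of_var_ne_zero _ one_ne_zero,
    ← withDensity_mul _ (measurable_gaussianPDF a 1) (by fun_prop)]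
  congr 1
  funext x
  rw [Pi.mul_apply, gaussianPDF, gaussianPDF, ← ENNReal.ofReal_mul (gaussianPDFReal_nonneg _ _ _),
    gaussianPDFReal, gaussianPDFReal, mul_assoc _ (Real.exp _) (Real.exp _), ← Real.exp_add]
  congr 4
  push_cast
  ring

/-- The law of a Gaussian vector with mean `a` and identity covariance, on real functions. -/
noncomputable abbrev gaussianLaw {ι : Type*} [Fintype ι] (a : ι → ℝ) : Measure (ι → ℝ) :=
  Measure.pi fun i => gaussianReal (a i) 1

theorem gaussianLaw_eq_withDensity_gaussianLaw {ι : Type*} [Fintype ι] (a b : ι → ℝ) :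
    gaussianLaw b = (gaussianLaw a).withDensity (fun x => ENNReal.ofReal
      (Real.exp (∑ i, ((b i - a i) * (x i - a i) - (b i - a i) ^ 2 / 2)))) := by
  have hsf (i : ι) : SigmaFinite ((gaussianReal (a i) 1).withDensity (fun x =>
      ENNReal.ofReal (Real.exp ((b i - a i) * (x - a i) - (b i - a i) ^ 2 / 2)))) := by
    rw [← gaussianReal_eq_withDensity_gaussianReal]; infer_instance
  have h := pi_withDensity_eq_withDensity_prod (fun i => gaussianReal (a i) 1)
    (g := fun i x => ENNReal.ofReal (Real.exp ((b i - a i) * (x - a i) - (b i - a i) ^ 2 / 2)))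
    (fun i => by fun_prop)
  simp_rw [← gaussianReal_eq_withDensity_gaussianReal] at h
  rw [gaussianLaw, h]
  congr 1
  funext x
  rw [Real.exp_sum, ENNReal.ofReal_prod_of_nonneg fun i _ => (Real.exp_pos _).le]

/-- The densities `u`, `v` of the shifts to `b` and to its reflection `2a - b` satisfy `u * v = exp
(-S) ≥ 1/3`, the linear terms cancelling. By AM-GM `3u + v/4 ≥ 1`; integrate over `A` and bound the
reflected law by one. -/
theorem gaussianLaw_real_le {ι : Type*} [Fintype ι] {a b : ι → ℝ}
    (hab : ∑ i, (b i - a i) ^ 2 ≤ 1) {A : Set (ι → ℝ)} (hA : MeasurableSet A) :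
    (gaussianLaw a).real A ≤ 3 * (gaussianLaw b).real A + 1 / 4 := by
  set S := ∑ i, (b i - a i) ^ 2
  set c : ι → ℝ := fun i => 2 * a i - b i with hc
  have key (x : ι → ℝ) :
      (1 : ENNReal) ≤ 3 * ENNReal.ofReal
          (Real.exp (∑ i, ((b i - a i) * (x i - a i) - (b i - a i) ^ 2 / 2))) +
        ENNReal.ofReal (1 / 4) * ENNReal.ofReal
          (Real.exp (∑ i, ((c i - a i) * (x i - a i) - (c i - a i) ^ 2 / 2))) := by
    set u := Real.exp (∑ i, ((b i - a i) * (x i - a i) - (b i - a i) ^ 2 / 2)) with hu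
    set v := Real.exp (∑ i, ((c i - a i) * (x i - a i) - (c i - a i) ^ 2 / 2)) with hv
    have hu0 : 0 < u := Real.exp_pos _
    have hv0 : 0 < v := Real.exp_pos _
    have huv : u * v = Real.exp (-S) := by
      rw [hu, hv, ← Real.exp_add, ← Finset.sum_add_distrib, ← Finset.sum_neg_distrib]
      congr 1
      refine Finset.sum_congr rfl fun i _ => ?_
      simp only [hc]
      ring
    have hexp : 1 / 3 ≤ u * v := by
      have h1 : Real.exp S < 3 :=
        (Real.exp_le_exp.2 hab).trans_lt (Real.exp_one_lt_d9.trans (by norm_num))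
      rw [huv, Real.exp_neg, ← one_div]
      exact one_div_le_one_div_of_le (Real.exp_pos _) h1.le
    have h3 : (3 : ENNReal) = ENNReal.ofReal 3 := by simp
    rw [h3, ← ENNReal.ofReal_mul (by norm_num), ← ENNReal.ofReal_mul (by norm_num),
      ← ENNReal.ofReal_add (by positivity) (by positivity), ← ENNReal.ofReal_one]
    refine ENNReal.ofReal_le_ofReal ?_
    nlinarith [sq_nonneg (3 * u - 1 / 4 * v)]
  have hle : gaussianLaw a A ≤
      3 * gaussianLaw b A + ENNReal.ofReal (1 / 4) * gaussianLaw c A := by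
    rw [gaussianLaw_eq_withDensity_gaussianLaw a b, gaussianLaw_eq_withDensity_gaussianLaw a c,
      withDensity_apply _ hA, withDensity_apply _ hA,
      ← lintegral_const_mul _ (by fun_prop), ← lintegral_const_mul _ (by fun_prop),
      ← lintegral_add_left (by fun_prop)]
    calc gaussianLaw a A = ∫⁻ _ in A, 1 ∂(gaussianLaw a) := by simp
      _ ≤ _ := lintegral_mono key
  have hc1 : (gaussianLaw c).real A ≤ 1 := measureReal_le_one
  have h := ENNReal.toReal_mono (by finiteness) hle
  rw [ENNReal.toReal_add (by finiteness) (by finiteness), ENNReal.toReal_mul,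
    ENNReal.toReal_mul, ENNReal.toReal_ofReal (by norm_num)] at h
  simp only [Measure.real, ENNReal.toReal_ofNat] at h hc1 ⊢
  linarith

/-- Two Gaussian shifts at distance at most one cannot be told apart reliably. -/
theorem one_quarter_le_gaussianLaw_add {ι : Type*} [Fintype ι] {a b : ι → ℝ}
    (hab : ∑ i, (b i - a i) ^ 2 ≤ 1) {A B : Set (ι → ℝ)} (hB : MeasurableSet B)
    (hAB : A ∪ B = Set.univ) :
    1 / 4 ≤ (gaussianLaw a).real A + (gaussianLaw b).real B := by
  have h1 : (1 : ℝ) ≤ (gaussianLaw a).real A + (gaussianLaw a).real B := by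
    have h := measureReal_union_le (μ := gaussianLaw a) A B
    rwa [hAB, probReal_univ] at h
  have h2 := gaussianLaw_real_le hab hB
  have h3 : 0 ≤ (gaussianLaw a).real A := measureReal_nonneg
  linarith

theorem dataLaw_eq_gaussianLaw {m : ℕ} {d : Fin m → ℕ} (Θ : Tensor d) :
    dataLaw Θ = gaussianLaw Θ := by
  have hmap (i : (k : Fin m) → Fin (d k)) :
      (gaussianReal 0 1).map (fun x => Θ i + x) = gaussianReal (Θ i) 1 := by
    rw [gaussianReal_map_const_add, zero_add]
  have hsf (i : (k : Fin m) → Fin (d k)) :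
      SigmaFinite ((gaussianReal 0 1).map (fun x => Θ i + x)) := by
    rw [hmap]; infer_instance
  have h := Measure.pi_map_pi (μ := fun _ : (k : Fin m) → Fin (d k) => gaussianReal 0 1)
    (f := fun i x => Θ i + x) (fun i => by fun_prop)
  simp_rw [hmap] at h
  exact h

/-! ### Linear functions in the latent model -/

theorem ContinuousLinearMap.iteratedFDeriv_add_two {E F : Type*} [NormedAddCommGroup E]
    [NormedSpace ℝ E] [NormedAddCommGroup F] [NormedSpace ℝ F] (L : E →L[ℝ] F) (n : ℕ) :
    iteratedFDeriv ℝ (n + 2) L = 0 := by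
  have hconst : fderiv ℝ L = fun _ => L := by
    funext x
    exact L.fderiv
  funext x
  rw [Pi.zero_apply, ← norm_eq_zero, ← norm_iteratedFDeriv_fderiv, hconst, iteratedFDeriv_succ_const]
  simp

theorem norm_coordVec_le {m : ℕ} {s : Fin m → ℕ} (c : Coord s) : ‖coordVec c‖ ≤ 1 := by
  simp [coordVec, Pi.norm_single]

/-- Only orders 0 and 1 can be nonzero: order 0 needs the bound 1, order 1 the bound `M`, whence
`min 1 M`. -/
theorem ContinuousLinearMap.isMAnalytic {m : ℕ} {s : Fin m → ℕ} {M : ℝ}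
    (hM : 0 < M) (L : LatentSpace s →L[ℝ] ℝ) (hL : ‖L‖ ≤ min 1 M) : IsMAnalytic s M L := by
  refine ⟨L.analyticOnNhd _, fun x hx α j _ => ?_⟩
  have hbound (y : LatentSpace s) (hy : ‖y‖ ≤ 1) : |L y| ≤ min 1 M := by
    calc |L y| ≤ ‖L‖ * ‖y‖ := L.le_opNorm y
      _ ≤ ‖L‖ * 1 := by gcongr
      _ ≤ min 1 M := by linarith
  have hderiv (n : ℕ) (v : Fin n → LatentSpace s) (hv : ∀ i, ‖v i‖ ≤ 1) :
      |iteratedFDeriv ℝ n L x v| ≤ M ^ n := by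
    match n with
    | 0 => simpa using (hbound x (by simpa using hx)).trans (min_le_left _ _)
    | 1 => simpa [iteratedFDeriv_one_apply] using (hbound _ (hv 0)).trans (min_le_right _ _)
    | n + 2 =>
      rw [L.iteratedFDeriv_add_two]
      simpa using pow_nonneg hM.le _
  have hfact : (1 : ℝ) ≤ ((∏ c, (α c)! : ℕ) : ℝ) := by
    exact_mod_cast Nat.one_le_iff_ne_zero.2
      (Finset.prod_ne_zero_iff.2 fun c _ => Nat.factorial_ne_zero _)
  calc |iteratedFDeriv ℝ (∑ c, α c) L x (fun i => coordVec (j i))|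
      ≤ M ^ (∑ c, α c) := hderiv _ _ fun i => norm_coordVec_le _
    _ ≤ M ^ (∑ c, α c) * ((∏ c, (α c)! : ℕ) : ℝ) :=
      le_mul_of_one_le_right (pow_nonneg hM.le _) hfact

theorem mem_latentTensorModel_of_apply_eq {m : ℕ} {d s : Fin m → ℕ} {M : ℝ} (hM : 0 < M)
    (k : Fin m) (hk : 1 ≤ s k) (t : Fin (d k) → ℝ) (ht : ∀ i, |t i| ≤ 1) :
    (show Tensor d from fun i => min 1 M * t (i k)) ∈ latentTensorModel d s M := by
  have hmin : 0 < min 1 M := lt_min one_pos hM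
  let L : LatentSpace s →L[ℝ] ℝ := min 1 M •
    (ContinuousLinearMap.proj ⟨0, hk⟩ : (Fin (s k) → ℝ) →L[ℝ] ℝ).comp
      (ContinuousLinearMap.proj k : LatentSpace s →L[ℝ] Fin (s k) → ℝ)
  have hL : ‖L‖ ≤ min 1 M := by
    refine L.opNorm_le_bound hmin.le fun y => ?_
    have h1 : ‖y k ⟨0, hk⟩‖ ≤ ‖y‖ := (norm_le_pi_norm (y k) _).trans (norm_le_pi_norm y k)
    calc ‖L y‖ = min 1 M * ‖y k ⟨0, hk⟩‖ := by
          simp [L, abs_of_pos hmin]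
      _ ≤ min 1 M * ‖y‖ := by gcongr
  -- `L` sees mode `k` only, so the other latent vectors may be zero.
  refine ⟨L, L.isMAnalytic hM hL, fun l i _ => if h : l = k then t (h ▸ i) else 0,
    fun l i => ?_, fun i => ?_⟩
  · rw [mem_closedBall_zero_iff, pi_norm_le_iff_of_nonneg zero_le_one]
    intro _
    dsimp only
    split_ifs with h
    · exact ht _
    · simp
  · simp [L]

/-! ### Assouad's argument and the minimax bound -/

/-- A lower bound over a hypercube, in probability: if no event `A j ω` can be made unlikely both at
`ω` and at its neighbour in direction `j`, then at some vertex a fixed proportion of the events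
occurs with a fixed probability. -/
theorem exists_le_measureReal_card_of_hypercube {J Y : Type*} [Fintype J] [Nonempty J]
    [DecidableEq J] [MeasurableSpace Y] (P : (J → Bool) → Measure Y)
    [∀ ω, IsProbabilityMeasure (P ω)] (A : J → (J → Bool) → Set Y)
    (hA : ∀ j ω, MeasurableSet (A j ω))
    (h : ∀ j ω, 1 / 4 ≤ (P ω).real (A j ω) +
      (P (Function.update ω j (!ω j))).real (A j (Function.update ω j (!ω j)))) :
    ∃ ω, 1 / 16 ≤ (P ω).real
      {y | (Fintype.card J : ℝ) / 16 ≤ ∑ j, (A j ω).indicator (fun _ => (1 : ℝ)) y} := by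
  have hflip (j : J) :
      Function.Involutive fun ω : J → Bool => Function.update ω j (!ω j) := fun ω => by
    simp
  -- Flipping coordinate `j` permutes the cube, so summing `h` counts each vertex twice.
  have hsum (j : J) : ∑ _ω : J → Bool, (1 / 8 : ℝ) ≤ ∑ ω, (P ω).real (A j ω) := by
    have h1 : ∑ ω, (P (Function.update ω j (!ω j))).real (A j (Function.update ω j (!ω j))) =
        ∑ ω, (P ω).real (A j ω) :=
      (hflip j).toPerm.sum_comp _ (fun ω => (P ω).real (A j ω)) (by simp)
    have h2 : ∑ _ω : J → Bool, (1 / 4 : ℝ) ≤ _ := Finset.sum_le_sum fun ω _ => h j ω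
    rw [Finset.sum_add_distrib, h1] at h2
    have h3 : ∑ _ω : J → Bool, (1 / 4 : ℝ) = 2 * ∑ _ω : J → Bool, (1 / 8 : ℝ) := by
      rw [Finset.mul_sum]; norm_num
    linarith
  obtain ⟨ω, -, hω⟩ : ∃ ω ∈ Finset.univ,
      ∑ _j : J, (1 / 8 : ℝ) ≤ ∑ j, (P ω).real (A j ω) := by
    refine Finset.exists_le_of_sum_le Finset.univ_nonempty ?_
    rw [Finset.sum_comm, Finset.sum_comm (f := fun ω j => (P ω).real (A j ω))]
    exact Finset.sum_le_sum fun j _ => hsum j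
  refine ⟨ω, ?_⟩
  set N : ℝ := (Fintype.card J : ℝ) with hN
  have hN0 : 0 < N := by rw [hN]; exact_mod_cast Fintype.card_pos
  set H : Y → ℝ := fun y => ∑ j, (A j ω).indicator (fun _ => (1 : ℝ)) y with hH
  have hHm : Measurable H :=
    Finset.measurable_fun_sum _ fun j _ => measurable_const.indicator (hA j ω)
  set E : Set Y := {y | N / 16 ≤ H y}
  have hE : MeasurableSet E := measurableSet_le measurable_const hHm
  have hint (B : Set Y) (hB : MeasurableSet B) (c : ℝ) :
      Integrable (B.indicator fun _ => c) (P ω) := (integrable_const c).indicator hB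
  have hHint : ∫ y, H y ∂(P ω) = ∑ j, (P ω).real (A j ω) := by
    rw [hH, integral_finsetSum _ fun j _ => hint _ (hA j ω) 1]
    exact Finset.sum_congr rfl fun j _ => by
      rw [integral_indicator_const _ (hA j ω), smul_eq_mul, mul_one]
  -- Reverse Markov: `H ≤ N` has mean at least `N / 8`, so it exceeds `N / 16` with probability at
  -- least `1 / 16`.
  have hHle (y : Y) : H y ≤ E.indicator (fun _ => N) y + N / 16 := by
    by_cases hy : y ∈ E
    · have h1 : H y ≤ ∑ _j : J, (1 : ℝ) :=
        Finset.sum_le_sum fun j _ => Set.indicator_le_self' (fun _ _ => zero_le_one) y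
      simp only [Finset.sum_const, Finset.card_univ, nsmul_eq_mul, mul_one] at h1
      rw [Set.indicator_of_mem hy]
      linarith
    · rw [Set.indicator_of_notMem hy, zero_add]
      exact (not_le.1 hy).le
  have hle : ∫ y, H y ∂(P ω) ≤ (P ω).real E * N + N / 16 := by
    calc ∫ y, H y ∂(P ω) ≤ ∫ y, (E.indicator (fun _ => N) y + N / 16) ∂(P ω) :=
          integral_mono (integrable_finsetSum _ fun j _ => hint _ (hA j ω) 1)
            ((hint _ hE N).add (integrable_const _)) hHle
      _ = _ := by
          rw [integral_add (hint _ hE N) (integrable_const _), integral_indicator_const _ hE]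
          simp
  rw [hHint] at hle
  simp only [Finset.sum_const, Finset.card_univ, nsmul_eq_mul] at hω
  have h5 : 1 / 16 * N ≤ (P ω).real E * N := by linarith
  exact le_of_mul_le_mul_right h5 hN0

/-- For means constant on the fibres of `π`, with the fibre over `j` carrying a mean whose two
possible values differ by `c` in Euclidean norm, every estimator has, for some choice of the values,
a squared error of the order of the number of fibres. -/
theorem exists_le_gaussianLaw_sq_error {ι J : Type*} [Fintype ι] [Fintype J] [Nonempty J]
    [DecidableEq J] {π : ι → J} (hπ : Function.Surjective π) {c : ℝ} (hc0 : 0 ≤ c) (hc1 : c ≤ 1)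
    {est : (ι → ℝ) → ι → ℝ} (hest : Measurable est) :
    ∃ t : J → ℝ, (∀ j, |t j| ≤ 1) ∧
      1 / 16 ≤ (gaussianLaw fun i => c * t (π i)).real
        {y | c ^ 2 / 64 * Fintype.card J ≤ ∑ i, (est y i - c * t (π i)) ^ 2} := by
  set n : J → ℝ := fun j => ((Finset.univ.filter fun i => π i = j).card : ℝ)
  have hn (j : J) : 1 ≤ n j := by
    obtain ⟨i, hi⟩ := hπ j
    exact Nat.one_le_cast.2 (Finset.card_pos.2 ⟨i, by simpa using hi⟩)
  -- With `n j` entries in the fibre, this step makes the two means differ by exactly `c` in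
  -- Euclidean norm.
  set δ : J → ℝ := fun j => (√(n j))⁻¹
  have hδ0 (j : J) : 0 ≤ δ j := by positivity
  have hδ1 (j : J) : δ j ≤ 1 := inv_le_one_of_one_le₀ (Real.one_le_sqrt.2 (hn j))
  have hδn (j : J) : n j * δ j ^ 2 = 1 := by
    rw [inv_pow, Real.sq_sqrt (zero_le_one.trans (hn j)),
      mul_inv_cancel₀ (zero_lt_one.trans_le (hn j)).ne']
  set t : (J → Bool) → J → ℝ := fun ω j => if ω j then δ j else 0 with ht
  set loss : J → (J → Bool) → (ι → ℝ) → ℝ :=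
    fun j ω y => ∑ i with π i = j, (est y i - c * t ω j) ^ 2 with hloss
  have hestm (i : ι) : Measurable fun y => est y i := (measurable_pi_apply i).comp hest
  have hlossm (j : J) (ω : J → Bool) : Measurable (loss j ω) :=
    Finset.measurable_fun_sum _ fun i _ => ((hestm i).sub_const _).pow_const 2
  have hdiff (j : J) (ω : J → Bool) :
      (t (Function.update ω j (!ω j)) j - t ω j) ^ 2 = δ j ^ 2 := by
    cases hb : ω j <;> simp [ht, hb]
  obtain ⟨ω, hω⟩ := exists_le_measureReal_card_of_hypercube
    (fun ω => gaussianLaw fun i => c * t ω (π i)) (fun j ω => {y | c ^ 2 / 4 ≤ loss j ω y})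
    (fun j ω => measurableSet_le measurable_const (hlossm j ω)) (fun j ω => by
      refine one_quarter_le_gaussianLaw_add ?_
        (measurableSet_le measurable_const (hlossm j _)) ?_
      · rw [← Finset.sum_fiberwise Finset.univ π, Finset.sum_eq_single j]
        · calc _ = ∑ i with π i = j, c ^ 2 * δ j ^ 2 := by
                refine Finset.sum_congr rfl fun i hi => ?_
                rw [(Finset.mem_filter.1 hi).2, ← mul_sub, mul_pow, hdiff]
            _ = c ^ 2 * (n j * δ j ^ 2) := by
                rw [Finset.sum_const, nsmul_eq_mul]; ring
            _ ≤ 1 := by rw [hδn, mul_one]; exact pow_le_one₀ hc0 hc1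
        · refine fun l _ hl => Finset.sum_eq_zero fun i hi => ?_
          rw [(Finset.mem_filter.1 hi).2]
          simp [ht, Function.update_of_ne hl]
        · simp
      · refine Set.eq_univ_of_forall fun y => ?_
        by_contra hy
        simp only [Set.mem_union, Set.mem_ofPred_eq, not_or, not_le] at hy
        -- From `p ^ 2 + q ^ 2 ≥ (p - q) ^ 2 / 2`: the two losses sum to at least `c ^ 2 / 2`, so
        -- they cannot both be below `c ^ 2 / 4`.
        have h1 : ∑ i with π i = j, c ^ 2 * δ j ^ 2 / 2 ≤
            loss j ω y + loss j (Function.update ω j (!ω j)) y := by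
          rw [hloss, ← Finset.sum_add_distrib]
          refine Finset.sum_le_sum fun i _ => ?_
          rw [← hdiff j ω]
          nlinarith [sq_nonneg ((est y i - c * t ω j) +
            (est y i - c * t (Function.update ω j (!ω j)) j))]
        have h2 : ∑ i with π i = j, c ^ 2 * δ j ^ 2 / 2 = c ^ 2 / 2 * (n j * δ j ^ 2) := by
          rw [Finset.sum_const, nsmul_eq_mul]; ring
        rw [h2, hδn] at h1
        linarith [hy.1, hy.2])
  refine ⟨t ω, fun j => ?_, hω.trans (measureReal_mono fun y hy => ?_)⟩
  · cases hb : ω j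
    · simp [ht, hb]
    · simpa [ht, hb, abs_of_nonneg (hδ0 j)] using hδ1 j
  · rw [Set.mem_ofPred_eq] at hy ⊢
    calc c ^ 2 / 64 * Fintype.card J = c ^ 2 / 4 * ((Fintype.card J : ℝ) / 16) := by ring
      _ ≤ c ^ 2 / 4 * ∑ j, {y | c ^ 2 / 4 ≤ loss j ω y}.indicator (fun _ => (1 : ℝ)) y := by
          gcongr
      _ ≤ ∑ j, loss j ω y := by
          rw [Finset.mul_sum]
          refine Finset.sum_le_sum fun j _ => ?_
          by_cases hj : y ∈ {y | c ^ 2 / 4 ≤ loss j ω y}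
          · rw [Set.indicator_of_mem hj, mul_one]
            exact hj
          · rw [Set.indicator_of_notMem hj, mul_zero]
            exact Finset.sum_nonneg fun i _ => sq_nonneg _
      _ = ∑ i, (est y i - c * t ω (π i)) ^ 2 := by
          rw [← Finset.sum_fiberwise Finset.univ π]
          refine Finset.sum_congr rfl fun j _ => Finset.sum_congr rfl fun i hi => ?_
          rw [(Finset.mem_filter.1 hi).2]

/-- Minimax lower bound: the probability bound `p₀` is absolute; the constant `C` depends only on
the model configuration (the order `m`, the latent dimensions `s` and `M`), not on `d`. The infimum
ranges over all estimators, i.e. measurable functions of the data tensor. -/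
theorem theorem3 :
    ∃ p₀ : ℝ, 0 < p₀ ∧ p₀ < 1 ∧
      ∀ (m : ℕ) (_ : 1 ≤ m) (s : Fin m → ℕ) (_ : ∀ k, 1 ≤ s k) (M : ℝ) (_ : 0 < M),
        ∃ C : ℝ, 0 < C ∧
          ∀ (d : Fin m → ℕ) (_ : ∀ k, 1 ≤ d k),
            ENNReal.ofReal p₀ ≤
              ⨅ (est : Tensor d → Tensor d) (_ : Measurable est),
                ⨆ Θ ∈ latentTensorModel d s M,
                  dataLaw Θ {Y | C * (maxDim d : ℝ) ≤ frobeniusNorm (est Y - Θ) ^ 2} := by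
  refine ⟨1 / 16, by norm_num, by norm_num, fun m hm s hs M hM => ?_⟩
  have hmin : 0 < min 1 M := lt_min one_pos hM
  refine ⟨min 1 M ^ 2 / 64, by positivity, fun d hd => le_iInf₂ fun est hest => ?_⟩
  obtain ⟨k, -, hk⟩ := Finset.exists_mem_eq_sup Finset.univ ⟨⟨0, hm⟩, Finset.mem_univ _⟩ d
  have hne (l : Fin m) : Nonempty (Fin (d l)) := ⟨⟨0, hd l⟩⟩
  obtain ⟨t, ht, hlaw⟩ := exists_le_gaussianLaw_sq_error
    (π := fun i : (l : Fin m) → Fin (d l) => i k) (Function.surjective_eval k) hmin.le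
    (min_le_left 1 M) hest
  refine le_iSup₂_of_le _ (mem_latentTensorModel_of_apply_eq hM k (hs k) t ht) ?_
  rw [dataLaw_eq_gaussianLaw, ENNReal.ofReal_le_iff_le_toReal (by finiteness)]
  refine hlaw.trans (measureReal_mono fun Y hY => ?_)
  rw [Set.mem_ofPred_eq, Fintype.card_fin] at hY
  rw [Set.mem_ofPred_eq, frobeniusNorm, maxDim, hk,
    Real.sq_sqrt (Finset.sum_nonneg fun _ _ => sq_nonneg _)]
  exact hY
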